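/- Fix an integer $d \ge 3$. For each $n \ge 1$ let $A_n \subseteq [n] = \{1, \dots, n\}$, with $|A_n| \to \infty$, and let $c_n$ be positive integers with $c_n \to \infty$. Color the elements of $A_n$ independently and uniformly at random with $c_n$ colors, that is, the colors of the elements of $A_n$ are independent and each of the $c_n$ colors has probability $1/c_n$. For $r \ge 3$, an $r$-AP in $A_n$ is a set $\{a, a+q, \dots, a+(r-1)q\} \subseteq A_n$ with common difference $q \ge 1$, and $W_r(A_n)$ denotes the number of $r$-APs in $A_n$ all of whose elements have the same color. Suppose that for every $3 \le r \le d$ there is a constant $\lambda_r \ge 0$ such that $$\lim_{n\to\infty} \mathbb{E}\, W_r(A_n) = \lim_{n\to\infty} \operatorname{Var} W_r(A_n) = \lambda_r .$$ Then, as $n \to \infty$, the random vector $(W_3(A_n), \dots, W_d(A_n))$ converges in distribution to $(Z_3, \dots, Z_d)$, where $Z_3, \dots, Z_d$ are independent and $Z_r \sim \mathrm{Pois}(\lambda_r)$ for $3 \le r \le d$ (with $\mathrm{Pois}(0)$ the point mass at $0$). -/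

import Mathlib

open MeasureTheory ProbabilityTheory Filter Topology
open scoped NNReal ENNReal

/-- `e` is (the set of terms of) an arithmetic progression with `r` terms:
`e = {a, a + q, …, a + (r - 1) q}` for some `a` and some common difference `q > 0`. -/
def IsArithProg (r : ℕ) (e : Finset ℕ) : Prop :=
  ∃ a q : ℕ, 0 < q ∧ e = (Finset.range r).image (fun i => a + i * q)

open Classical in
/-- The collection of all `r`-term arithmetic progressions contained in `A`, as sets of integers. -/
noncomputable def arithProgs (A : Finset ℕ) (r : ℕ) : Finset (Finset ℕ) :=
  {e ∈ A.powerset | IsArithProg r e}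

/-- The set `e` is monochromatic under the coloring `x` of the elements of `A`. -/
def IsMonochromatic {κ : Type*} {A : Finset ℕ} (x : A → κ) (e : Finset ℕ) : Prop :=
  ∀ u v : A, (u : ℕ) ∈ e → (v : ℕ) ∈ e → x u = x v

open Classical in
/-- The number of `r`-term arithmetic progressions in `A` that are monochromatic under the
coloring `x`. -/
noncomputable def numMonoAP {κ : Type*} (A : Finset ℕ) (r : ℕ) (x : A → κ) : ℕ :=
  Finset.card {e ∈ arithProgs A r | IsMonochromatic x e}

/-! The heart is the Poisson limit of `W_3`, by the Stein–Chen method with a size-bias coupling.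
View the 3-APs as edges of a 3-uniform hypergraph `H` in which two vertices share at most `D = 3`
edges. For an edge `e` with a vertex `u`, giving all of `e` the color of `u` turns a uniform
coloring into one conditioned on `e` being monochromatic (`card_recolor`). This typically raises the
number `W` of monochromatic edges by exactly one, so `c² P(e mono, W = k+1) ≈ P(W = k)`. Summing
over `e` gives `(k+1) P(W = k+1) ≈ μ P(W = k)` with `μ = |H|/c²`, the recursion of the Poisson law.

The coupling errs only if `e` was already monochromatic, or if some other edge meeting `e` outside
`u` is monochromatic before or after recoloring. Hence `u` is chosen of maximal degree in `e`: the
bad edges then pass through the two vertices of smaller degree, and a degree `deg v` is at most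
`√(deg u · deg v)`. By Cauchy–Schwarz and the codegree bound, the number of bad edges summed over
`e` is `O(|H|^{3/2}) = O(c³)`, which leaves a total error `O(1/c)`. An arbitrary `u` would not
suffice: if one vertex lies on all edges, `∑ deg²` is of order `c⁴`.

For `r ≥ 4` there are no more `r`-APs than 3-APs, so `E W_r ≤ E W_3 / c → 0`. Thus `λ_r = 0` and
`W_r = 0` with high probability, and the joint limit with independence reduces to the limit of
`W_3`. -/

/-! ### Recoloring a set of vertices with one color -/

section Recoloring

open Classical

variable {V K ι : Type*}

/-- The coloring `x` is constant on the set `T`. -/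
def ConstOn (x : V → K) (T : Finset V) : Prop := ∀ u ∈ T, ∀ v ∈ T, x u = x v

/-- The coloring obtained from `x` by giving all elements of `T` the color of `u`. -/
noncomputable def recolor (T : Finset V) (u : V) (x : V → K) : V → K :=
  fun v => if v ∈ T then x u else x v

/-- The number of members of the family `E`, indexed by `H`, on which `x` is constant. -/
noncomputable def numConst (H : Finset ι) (E : ι → Finset V) (x : V → K) : ℕ :=
  Finset.card {e ∈ H | ConstOn x (E e)}

theorem constOn_recolor (T : Finset V) (u : V) (x : V → K) : ConstOn (recolor T u x) T := by
  intro v hv w hw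
  simp [recolor, hv, hw]

theorem recolor_of_constOn {T : Finset V} {u : V} (hu : u ∈ T) {x : V → K} (hx : ConstOn x T) :
    recolor T u x = x := by
  funext v
  by_cases hv : v ∈ T
  · simp [recolor, hv, hx u hu v hv]
  · simp [recolor, hv]

variable [DecidableEq V]

/-- After recoloring along `T`, the coloring is constant on a set `S` meeting `T` iff the original
one is constant on `S \ T` together with the reference point. -/
theorem constOn_of_constOn_recolor {T S : Finset V} {u : V} (hST : (S ∩ T).Nonempty)
    {x : V → K} (h : ConstOn (recolor T u x) S) (hu : u ∈ T) :
    ConstOn x (insert u (S \ T)) := by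
  obtain ⟨w, hw⟩ := hST
  obtain ⟨hwS, hwT⟩ := Finset.mem_inter.1 hw
  have key : ∀ v ∈ insert u (S \ T), x v = x u := by
    intro v hv
    rcases Finset.mem_insert.1 hv with rfl | hv
    · rfl
    · obtain ⟨hvS, hvT⟩ := Finset.mem_sdiff.1 hv
      have := h v hvS w hwS
      simpa [recolor, hvT, hwT] using this
  intro a ha b hb
  rw [key a ha, key b hb]

theorem constOn_recolor_iff {T S : Finset V} {u : V} (hST : ∀ v ∈ S, v ∈ T → v = u)
    (x : V → K) : ConstOn (recolor T u x) S ↔ ConstOn x S := by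
  have : ∀ v ∈ S, recolor T u x v = x v := by
    intro v hv
    by_cases hvT : v ∈ T
    · simp [recolor, hST v hv hvT]
    · simp [recolor, hvT]
  constructor
  · intro h a ha b hb
    rw [← this a ha, ← this b hb]; exact h a ha b hb
  · intro h a ha b hb
    rw [this a ha, this b hb]; exact h a ha b hb

variable [Fintype V] [Fintype K]

/-- Recoloring a uniformly random coloring along `T` yields a uniformly random coloring among
those constant on `T`. -/
theorem card_recolor {T : Finset V} {u : V} (hu : u ∈ T) (p : (V → K) → Prop) :
    Finset.card {x : V → K | p (recolor T u x)} =
      Fintype.card K ^ (T.card - 1) * Finset.card {x : V → K | ConstOn x T ∧ p x} := by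
  have hcard : Fintype.card K ^ (T.card - 1) =
      (Finset.univ : Finset ({a // a ∈ T.erase u} → K)).card := by
    rw [Finset.card_univ, Fintype.card_fun, Fintype.card_coe, Finset.card_erase_of_mem hu]
  rw [hcard, ← Finset.card_product]
  -- Recoloring forgets exactly the colors on `T` away from `u`; recording them makes it a
  -- bijection, inverted by writing them back.
  refine Finset.card_nbij' (fun x => (fun v : {a // a ∈ T.erase u} => x v, recolor T u x))
    (fun q v => if h : v ∈ T.erase u then q.1 ⟨v, h⟩ else q.2 v) ?_ ?_ ?_ ?_
  · intro x hx
    simp only [Finset.coe_filter, Finset.mem_univ, true_and, Set.mem_ofPred_eq] at hx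
    simp [constOn_recolor, hx]
  · rintro ⟨z, y⟩ hq
    simp only [Finset.coe_product, Finset.coe_univ, Finset.coe_filter, Finset.mem_univ, true_and,
      Set.mem_prod, Set.mem_univ, Set.mem_ofPred_eq] at hq
    simp only [Finset.coe_filter, Finset.mem_univ, true_and, Set.mem_ofPred_eq]
    convert hq.2 using 1
    rw [← recolor_of_constOn hu hq.1]
    funext v
    by_cases hv : v ∈ T
    · simp [recolor, hv]
    · simp [recolor, hv]
  · intro x _
    funext v
    by_cases hv : v ∈ T
    · by_cases hvu : v = u
      · subst hvu; simp [recolor, hv]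
      · simp [hv, hvu]
    · simp [recolor, hv]
  · rintro ⟨z, y⟩ hq
    simp only [Finset.coe_product, Finset.coe_univ, Finset.coe_filter, Finset.mem_univ, true_and,
      Set.mem_prod, Set.mem_univ, Set.mem_ofPred_eq] at hq
    refine Prod.ext ?_ ?_
    · funext v
      simp
    · funext v
      have h := congrFun (recolor_of_constOn hu hq.1) v
      by_cases hv : v ∈ T
      · simp only [recolor, hv, if_true] at h ⊢
        simpa using h
      · simp [recolor, hv]

theorem card_constOn {T : Finset V} (hT : T.Nonempty) :
    Fintype.card K ^ (T.card - 1) * Finset.card {x : V → K | ConstOn x T} =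
      Fintype.card K ^ Fintype.card V := by
  obtain ⟨u, hu⟩ := hT
  have := card_recolor (K := K) hu (fun _ => True)
  simpa using this.symm

end Recoloring

/-! ### Uniform colorings and the Stein–Chen estimate for 3-uniform hypergraphs -/

section UniformColoring

open Classical

variable {V K ι : Type*} [Fintype V] [DecidableEq V] [Fintype K]

/-- The probability that a uniformly random coloring of `V` by `K` has the property `p`. -/
noncomputable def colorProb (p : (V → K) → Prop) : ℝ :=
  (Finset.card {x : V → K | p x} : ℝ) / (Fintype.card K : ℝ) ^ Fintype.card V

theorem colorProb_nonneg (p : (V → K) → Prop) : 0 ≤ colorProb p := by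
  unfold colorProb; positivity

theorem colorProb_mono {p q : (V → K) → Prop} (h : ∀ x, p x → q x) :
    colorProb p ≤ colorProb q := by
  unfold colorProb
  gcongr with x
  exact h x

theorem colorProb_or_le (p q : (V → K) → Prop) :
    colorProb (fun x => p x ∨ q x) ≤ colorProb p + colorProb q := by
  unfold colorProb
  rw [← add_div]
  gcongr
  rw [← Nat.cast_add]
  refine Nat.cast_le.2 ((Finset.card_le_card ?_).trans (Finset.card_union_le _ _))
  intro x hx
  simpa using hx

theorem colorProb_exists_le (F : Finset ι) (p : ι → (V → K) → Prop) :
    colorProb (fun x => ∃ i ∈ F, p i x) ≤ ∑ i ∈ F, colorProb (p i) := by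
  unfold colorProb
  rw [← Finset.sum_div]
  gcongr
  rw [← Nat.cast_sum]
  refine Nat.cast_le.2 ((Finset.card_le_card ?_).trans Finset.card_biUnion_le)
  intro x hx
  simpa using hx

theorem abs_colorProb_sub_le {p q r : (V → K) → Prop} (h : ∀ x, ¬ r x → (p x ↔ q x)) :
    |colorProb p - colorProb q| ≤ colorProb r := by
  have h1 : colorProb p ≤ colorProb q + colorProb r :=
    (colorProb_mono fun x hx => by by_cases hr : r x <;> simp_all).trans (colorProb_or_le q r)
  have h2 : colorProb q ≤ colorProb p + colorProb r :=
    (colorProb_mono fun x hx => by by_cases hr : r x <;> simp_all).trans (colorProb_or_le p r)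
  rw [abs_le]
  constructor <;> linarith

theorem colorProb_recolor {T : Finset V} {u : V} (hu : u ∈ T) (p : (V → K) → Prop) :
    colorProb (fun x => p (recolor T u x)) =
      (Fintype.card K : ℝ) ^ (T.card - 1) * colorProb (fun x => ConstOn x T ∧ p x) := by
  unfold colorProb
  rw [card_recolor hu, mul_div_assoc']
  push_cast
  rfl

theorem colorProb_constOn (hK : 0 < Fintype.card K) {T : Finset V} (hT : T.Nonempty) :
    colorProb (fun x : V → K => ConstOn x T) = ((Fintype.card K : ℝ) ^ (T.card - 1))⁻¹ := by
  have hc : (0 : ℝ) < Fintype.card K := by exact_mod_cast hK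
  have h : (Fintype.card K : ℝ) ^ (T.card - 1) *
      (Finset.card {x : V → K | ConstOn x T} : ℝ) = (Fintype.card K : ℝ) ^ Fintype.card V := by
    exact_mod_cast card_constOn (K := K) hT
  unfold colorProb
  rw [← h]
  have : (Finset.card {x : V → K | ConstOn x T} : ℝ) ≠ 0 := by
    intro h0
    rw [h0, mul_zero] at h
    exact (pow_pos hc _).ne h
  field_simp

/-- The number of edges containing `v`. -/
noncomputable def edgeDegree (H : Finset ι) (E : ι → Finset V) (v : V) : ℕ :=
  Finset.card {e ∈ H | v ∈ E e}

theorem sum_edgeDegree (H : Finset ι) (E : ι → Finset V) :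
    ∑ v, edgeDegree H E v = ∑ e ∈ H, (E e).card := by
  unfold edgeDegree
  simp_rw [Finset.card_filter]
  rw [Finset.sum_comm]
  refine Finset.sum_congr rfl fun e _ => ?_
  rw [← Finset.card_filter, Finset.filter_univ_mem]

/-- After exchanging the sums, each ordered pair of distinct vertices is counted at most `D` times,
so the total is at most `D (∑ deg)² = D (3|H|)²`. -/
theorem sum_offDiag_edgeDegree_le {H : Finset ι} {E : ι → Finset V} {D : ℕ}
    (hE : ∀ e ∈ H, (E e).card = 3)
    (hD : ∀ u v, u ≠ v → Finset.card {e ∈ H | u ∈ E e ∧ v ∈ E e} ≤ D) :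
    ∑ e ∈ H, ∑ q ∈ (E e).offDiag, edgeDegree H E q.1 * edgeDegree H E q.2 ≤
      9 * D * H.card ^ 2 := by
  have h1 : ∑ e ∈ H, ∑ q ∈ (E e).offDiag, edgeDegree H E q.1 * edgeDegree H E q.2 =
      ∑ q : V × V, ∑ e ∈ H, if q ∈ (E e).offDiag then
        edgeDegree H E q.1 * edgeDegree H E q.2 else 0 := by
    rw [Finset.sum_comm]
    refine Finset.sum_congr rfl fun e _ => ?_
    rw [← Finset.sum_filter, Finset.filter_univ_mem]
  have h2 : ∀ q : V × V, (∑ e ∈ H, if q ∈ (E e).offDiag then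
        edgeDegree H E q.1 * edgeDegree H E q.2 else 0) ≤
      D * (edgeDegree H E q.1 * edgeDegree H E q.2) := by
    intro q
    rw [← Finset.sum_filter, Finset.sum_const, smul_eq_mul]
    refine Nat.mul_le_mul_right _ ?_
    by_cases hq : q.1 = q.2
    · simp [Finset.mem_offDiag, hq]
    · refine le_trans (Finset.card_le_card ?_) (hD q.1 q.2 hq)
      intro e he
      simp only [Finset.mem_filter, Finset.mem_offDiag] at he ⊢
      tauto
  rw [h1]
  refine (Finset.sum_le_sum fun q _ => h2 q).trans ?_
  rw [← Finset.mul_sum, Fintype.sum_prod_type]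
  simp only
  rw [← Finset.sum_mul_sum, sum_edgeDegree, Finset.sum_congr rfl hE, Finset.sum_const]
  refine le_of_eq ?_
  simp only [smul_eq_mul]
  ring

/-- Recoloring an edge along its vertex of largest degree changes the number of monochromatic
edges by exactly one, up to an event of small probability. -/
theorem abs_mul_colorProb_sub_le (hK : 0 < Fintype.card K) {H : Finset ι} {E : ι → Finset V}
    {D : ℕ} (hE : ∀ e ∈ H, (E e).card = 3) (hinj : Set.InjOn E H)
    (hD : ∀ u v, u ≠ v → Finset.card {e ∈ H | u ∈ E e ∧ v ∈ E e} ≤ D) {e : ι} (he : e ∈ H)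
    (k : ℕ) :
    |(Fintype.card K : ℝ) ^ 2 *
        colorProb (fun x : V → K => ConstOn x (E e) ∧ numConst H E x = k + 1) -
      colorProb (fun x : V → K => numConst H E x = k)| ≤
    ((Fintype.card K : ℝ) ^ 2)⁻¹ + 2 * ((Fintype.card K : ℝ) ^ 2)⁻¹ *
      √(2 * ∑ q ∈ (E e).offDiag, (edgeDegree H E q.1 * edgeDegree H E q.2 : ℝ)) +
      6 * D * (Fintype.card K : ℝ)⁻¹ := by
  set c : ℝ := ((Fintype.card K : ℕ) : ℝ) with hc
  have hc0 : 0 < c := by rw [hc]; exact_mod_cast hK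
  have hne : (E e).Nonempty := by
    rw [← Finset.card_pos, hE e he]; norm_num
  obtain ⟨u, hu, hmax⟩ := Finset.exists_max_image (E e) (edgeDegree H E) hne
  have h0 := colorProb_recolor (K := K) hu (fun x => numConst H E x = k + 1)
  rw [hE e he] at h0
  norm_num only at h0
  rw [← hc] at h0
  rw [← h0]
  -- `F` holds the edges whose status recoloring may change: an edge meeting `e` at most in `u`
  -- keeps its colors. Those in `F₂` share two vertices with `e`; after recoloring they are
  -- monochromatic with probability up to `1/c` instead of `1/c²`, so they are counted separately.
  let F : Finset ι := {f ∈ H | f ≠ e ∧ ∃ v ∈ (E e).erase u, v ∈ E f}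
  let F₂ : Finset ι := {f ∈ H | f ≠ e ∧ 1 < (E f ∩ E e).card}
  have hgood : ∀ x : V → K, ¬ (ConstOn x (E e) ∨
      ∃ f ∈ F, ConstOn x (E f) ∨ ConstOn (recolor (E e) u x) (E f)) →
      (numConst H E (recolor (E e) u x) = k + 1 ↔ numConst H E x = k) := by
    intro x hx
    push Not at hx
    obtain ⟨hxe, hxF⟩ := hx
    have : ({f ∈ H | ConstOn (recolor (E e) u x) (E f)} : Finset ι) =
        insert e ({f ∈ H | ConstOn x (E f)} : Finset ι) := by
      ext f
      simp only [Finset.mem_filter, Finset.mem_insert]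
      by_cases hfe : f = e
      · subst hfe
        simp [he, constOn_recolor]
      · by_cases hfH : f ∈ H
        · by_cases hfF : f ∈ F
          · simp [hfe, hxF f hfF]
          · simp only [hfH, hfe, true_and, false_or]
            refine constOn_recolor_iff ?_ x
            intro v hv hve
            by_contra hvu
            exact hfF (Finset.mem_filter.2 ⟨hfH, hfe, v, Finset.mem_erase.2 ⟨hvu, hve⟩, hv⟩)
        · simp [hfH, hfe]
    unfold numConst
    rw [this, Finset.card_insert_of_notMem (by simp [hxe])]
    omega
  refine (abs_colorProb_sub_le hgood).trans ?_
  have hterm : ∀ f ∈ F, colorProb (fun x : V → K =>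
      ConstOn x (E f) ∨ ConstOn (recolor (E e) u x) (E f)) ≤
      2 * (c ^ 2)⁻¹ + if 1 < (E f ∩ E e).card then c⁻¹ else 0 := by
    intro f hf
    obtain ⟨hfH, hfe, v, hve, hvf⟩ := Finset.mem_filter.1 hf
    have hv : v ∈ E f ∩ E e := Finset.mem_inter.2 ⟨hvf, Finset.mem_of_mem_erase hve⟩
    have hfne : (E f).Nonempty := ⟨v, hvf⟩
    refine (colorProb_or_le _ _).trans ?_
    have h1 := colorProb_constOn hK hfne
    rw [hE f hfH, ← hc] at h1
    norm_num only at h1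
    have h2 : colorProb (fun x : V → K => ConstOn (recolor (E e) u x) (E f)) ≤
        (c ^ (E f \ E e).card)⁻¹ := by
      refine (colorProb_mono fun x hx => constOn_of_constOn_recolor ⟨v, hv⟩ hx hu).trans ?_
      rw [colorProb_constOn hK ⟨u, Finset.mem_insert_self _ _⟩,
        Finset.card_insert_of_notMem (by simp [hu]), Nat.add_sub_cancel]
    have hsum : (E f \ E e).card + (E f ∩ E e).card = 3 := by
      rw [← hE f hfH]; exact Finset.card_sdiff_add_card_inter _ _
    have hpos : 0 < (E f ∩ E e).card := Finset.card_pos.2 ⟨v, hv⟩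
    -- Distinct edges of equal size are not nested, so `f` has one or two vertices outside `e`.
    have hlt : (E f \ E e).card ≠ 0 := by
      intro h
      have hsub : E f ⊆ E e := Finset.sdiff_eq_empty_iff_subset.1 (Finset.card_eq_zero.1 h)
      exact hfe (hinj hfH he (Finset.eq_of_subset_of_card_le hsub (by rw [hE f hfH, hE e he])))
    have hc2 : 0 ≤ (c ^ 2)⁻¹ := by positivity
    split_ifs with h
    · have : (E f \ E e).card = 1 := by omega
      rw [this, pow_one] at h2
      linarith
    · have : (E f \ E e).card = 2 := by omega
      rw [this] at h2
      linarith
  have hF : (F.card : ℝ) ≤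
      √(2 * ∑ q ∈ (E e).offDiag, (edgeDegree H E q.1 * edgeDegree H E q.2 : ℝ)) := by
    have h1 : F.card ≤ ∑ v ∈ (E e).erase u, edgeDegree H E v := by
      unfold edgeDegree
      refine (Finset.card_le_card ?_).trans Finset.card_biUnion_le
      intro f hf
      obtain ⟨hfH, hfe, v, hve, hvf⟩ := Finset.mem_filter.1 hf
      exact Finset.mem_biUnion.2 ⟨v, hve, Finset.mem_filter.2 ⟨hfH, hvf⟩⟩
    have h1' : (F.card : ℝ) ≤ ∑ v ∈ (E e).erase u, (edgeDegree H E v : ℝ) := by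
      exact_mod_cast h1
    refine h1'.trans (Real.le_sqrt_of_sq_le ?_)
    refine sq_sum_le_card_mul_sum_sq.trans ?_
    rw [Finset.card_erase_of_mem hu, hE e he]
    norm_num only [Nat.cast_ofNat]
    refine mul_le_mul_of_nonneg_left ?_ (by norm_num)
    -- Maximality of `u` enters here: `deg v ² ≤ deg u · deg v`, a sum over pairs that the codegree
    -- bound controls.
    calc ∑ v ∈ (E e).erase u, (edgeDegree H E v : ℝ) ^ 2
        ≤ ∑ v ∈ (E e).erase u, (edgeDegree H E u * edgeDegree H E v : ℝ) := by
          refine Finset.sum_le_sum fun v hv => ?_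
          rw [sq]
          refine mul_le_mul_of_nonneg_right ?_ (by positivity)
          exact_mod_cast hmax v (Finset.mem_of_mem_erase hv)
      _ = ∑ q ∈ ((E e).erase u).image (fun v => (u, v)),
            (edgeDegree H E q.1 * edgeDegree H E q.2 : ℝ) := by
          rw [Finset.sum_image]
          intro a _ b _ hab
          exact (Prod.ext_iff.1 hab).2
      _ ≤ _ := by
          refine Finset.sum_le_sum_of_subset_of_nonneg ?_ fun q _ _ => by positivity
          intro q hq
          obtain ⟨v, hv, rfl⟩ := Finset.mem_image.1 hq
          exact Finset.mem_offDiag.2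
            ⟨hu, Finset.mem_of_mem_erase hv, (Finset.ne_of_mem_erase hv).symm⟩
  -- An edge has six ordered pairs of distinct vertices, each in at most `D` edges.
  have hF₂ : (F₂.card : ℝ) ≤ 6 * D := by
    have : F₂.card ≤ ∑ q ∈ (E e).offDiag,
        Finset.card {f ∈ H | q.1 ∈ E f ∧ q.2 ∈ E f} := by
      refine (Finset.card_le_card ?_).trans Finset.card_biUnion_le
      intro f hf
      obtain ⟨hfH, hfe, hf2⟩ := Finset.mem_filter.1 hf
      obtain ⟨a, ha, b, hb, hab⟩ := Finset.one_lt_card.1 hf2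
      rw [Finset.mem_inter] at ha hb
      exact Finset.mem_biUnion.2 ⟨(a, b), Finset.mem_offDiag.2 ⟨ha.2, hb.2, hab⟩,
        Finset.mem_filter.2 ⟨hfH, ha.1, hb.1⟩⟩
    have h' : F₂.card ≤ 6 * D := by
      refine this.trans ((Finset.sum_le_card_nsmul _ _ D fun q hq => ?_).trans ?_)
      · exact hD _ _ (Finset.mem_offDiag.1 hq).2.2
      · rw [Finset.offDiag_card, hE e he]; simp
    exact_mod_cast h'
  have hsumF₂ : ∑ f ∈ F, (if 1 < (E f ∩ E e).card then c⁻¹ else 0) ≤ F₂.card * c⁻¹ := by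
    rw [← Finset.sum_filter, Finset.sum_const, nsmul_eq_mul]
    refine mul_le_mul_of_nonneg_right ?_ (by positivity)
    refine Nat.cast_le.2 (Finset.card_le_card ?_)
    intro f hf
    obtain ⟨hf1, hf2⟩ := Finset.mem_filter.1 hf
    obtain ⟨hfH, hfe, -⟩ := Finset.mem_filter.1 hf1
    exact Finset.mem_filter.2 ⟨hfH, hfe, hf2⟩
  have he' := colorProb_constOn hK hne
  rw [hE e he, ← hc] at he'
  norm_num only at he'
  refine (colorProb_or_le _ _).trans ?_
  rw [he', add_assoc]
  refine add_le_add le_rfl ?_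
  refine (colorProb_exists_le F _).trans ((Finset.sum_le_sum hterm).trans ?_)
  rw [Finset.sum_add_distrib, Finset.sum_const, nsmul_eq_mul]
  refine add_le_add ?_ (hsumF₂.trans (mul_le_mul_of_nonneg_right hF₂ (by positivity)))
  rw [mul_comm]
  exact mul_le_mul_of_nonneg_left hF (by positivity)

/-- An approximate Stein identity for the number of monochromatic edges. -/
theorem abs_succ_mul_colorProb_sub_le (hK : 0 < Fintype.card K) {H : Finset ι}
    {E : ι → Finset V} {D : ℕ} (hE : ∀ e ∈ H, (E e).card = 3) (hinj : Set.InjOn E H)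
    (hD : ∀ u v, u ≠ v → Finset.card {e ∈ H | u ∈ E e ∧ v ∈ E e} ≤ D) (k : ℕ) :
    |(k + 1) * colorProb (fun x : V → K => numConst H E x = k + 1) -
      H.card / (Fintype.card K : ℝ) ^ 2 * colorProb (fun x : V → K => numConst H E x = k)| ≤
    ((Fintype.card K : ℝ) ^ 2)⁻¹ * (H.card * ((Fintype.card K : ℝ) ^ 2)⁻¹ +
      2 * ((Fintype.card K : ℝ) ^ 2)⁻¹ * √(18 * D * H.card ^ 3) +
      H.card * (6 * D * (Fintype.card K : ℝ)⁻¹)) := by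
  set c : ℝ := ((Fintype.card K : ℕ) : ℝ) with hc
  have hc0 : 0 < c := by rw [hc]; exact_mod_cast hK
  set a : ℝ := colorProb (fun x : V → K => numConst H E x = k) with ha
  -- Double counting: a coloring with `W = k + 1` makes exactly `k + 1` edges constant.
  have hcount : (k + 1) * colorProb (fun x : V → K => numConst H E x = k + 1) =
      ∑ e ∈ H, colorProb (fun x : V → K => ConstOn x (E e) ∧ numConst H E x = k + 1) := by
    unfold colorProb
    rw [← Finset.sum_div, mul_div_assoc']
    congr 1
    rw [← Nat.cast_sum]
    norm_cast
    simp_rw [Finset.card_filter, ite_and]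
    rw [Finset.sum_comm, Finset.mul_sum]
    refine Finset.sum_congr rfl fun x _ => ?_
    by_cases hx : numConst H E x = k + 1
    · simp only [hx, if_true, mul_one]
      rw [← Finset.card_filter]
      exact hx.symm
    · simp [hx]
  have hsqrt : ∑ e ∈ H,
      √(2 * ∑ q ∈ (E e).offDiag, (edgeDegree H E q.1 * edgeDegree H E q.2 : ℝ)) ≤
      √(18 * D * H.card ^ 3) := by
    refine Real.le_sqrt_of_sq_le (sq_sum_le_card_mul_sum_sq.trans ?_)
    have h1 : ∑ e ∈ H,
        √(2 * ∑ q ∈ (E e).offDiag, (edgeDegree H E q.1 * edgeDegree H E q.2 : ℝ)) ^ 2 =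
        2 * ∑ e ∈ H, ∑ q ∈ (E e).offDiag, (edgeDegree H E q.1 * edgeDegree H E q.2 : ℝ) := by
      rw [Finset.mul_sum]
      exact Finset.sum_congr rfl fun e _ => Real.sq_sqrt (by positivity)
    have h2 : ∑ e ∈ H, ∑ q ∈ (E e).offDiag, (edgeDegree H E q.1 * edgeDegree H E q.2 : ℝ) ≤
        9 * D * H.card ^ 2 := by
      exact_mod_cast sum_offDiag_edgeDegree_le hE hD
    rw [h1]
    calc (H.card : ℝ) * (2 * _) ≤ H.card * (2 * (9 * D * H.card ^ 2)) := by gcongr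
      _ = _ := by ring
  have hdecomp : (k + 1) * colorProb (fun x : V → K => numConst H E x = k + 1) -
      H.card / c ^ 2 * a = (c ^ 2)⁻¹ * ∑ e ∈ H, (c ^ 2 *
        colorProb (fun x : V → K => ConstOn x (E e) ∧ numConst H E x = k + 1) - a) := by
    rw [hcount, Finset.sum_sub_distrib, ← Finset.mul_sum, Finset.sum_const, nsmul_eq_mul]
    field_simp
  rw [hdecomp, abs_mul, abs_of_nonneg (by positivity)]
  refine mul_le_mul_of_nonneg_left ?_ (by positivity)
  refine (Finset.abs_sum_le_sum_abs _ _).trans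
    ((Finset.sum_le_sum fun e he => abs_mul_colorProb_sub_le hK hE hinj hD he k).trans ?_)
  rw [Finset.sum_add_distrib, Finset.sum_add_distrib, Finset.sum_const, Finset.sum_const,
    ← Finset.mul_sum, nsmul_eq_mul, nsmul_eq_mul]
  gcongr

end UniformColoring

/-! ### Counting arithmetic progressions -/

section ArithProgs

open Classical

theorem mem_arithProgs {A : Finset ℕ} {r : ℕ} {e : Finset ℕ} :
    e ∈ arithProgs A r ↔ e ⊆ A ∧ IsArithProg r e := by
  simp [arithProgs]

theorem IsArithProg.card_eq {r : ℕ} {e : Finset ℕ} (h : IsArithProg r e) : e.card = r := by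
  obtain ⟨a, q, hq, rfl⟩ := h
  rw [Finset.card_image_of_injective, Finset.card_range]
  intro i j hij
  exact Nat.eq_of_mul_eq_mul_right hq (Nat.add_left_cancel hij)

/-- The three-term progression with first term `a` and difference `q`. -/
def threeTermProg (a q : ℕ) : Finset ℕ := (Finset.range 3).image (fun i => a + i * q)

theorem mem_threeTermProg {a q x : ℕ} :
    x ∈ threeTermProg a q ↔ x = a ∨ x = a + q ∨ x = a + 2 * q := by
  simp only [threeTermProg, Finset.mem_image, Finset.mem_range]
  constructor
  · rintro ⟨i, hi, rfl⟩
    interval_cases i <;> simp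
  · rintro (rfl | rfl | rfl)
    · exact ⟨0, by norm_num, by simp⟩
    · exact ⟨1, by norm_num, by simp⟩
    · exact ⟨2, by norm_num, rfl⟩

theorem threeTermProg_inj {a q a' q' : ℕ} (hq : 0 < q) (hq' : 0 < q')
    (h : threeTermProg a q = threeTermProg a' q') : a = a' ∧ q = q' := by
  have h1 : ∀ x, (x = a ∨ x = a + q ∨ x = a + 2 * q) ↔
      (x = a' ∨ x = a' + q' ∨ x = a' + 2 * q') := by
    intro x
    rw [← mem_threeTermProg, ← mem_threeTermProg, h]
  have h2 := (h1 a).1 (by simp)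
  have h3 := (h1 (a + q)).1 (by simp)
  have h4 := (h1 a').2 (by simp)
  have h5 := (h1 (a' + q')).2 (by simp)
  omega

/-- The first three terms of a progression determine its first term and difference, so truncation is
injective. -/
theorem card_arithProgs_le (A : Finset ℕ) {r : ℕ} (hr : 3 ≤ r) :
    (arithProgs A r).card ≤ (arithProgs A 3).card := by
  refine Finset.card_le_card_of_forall_subsingleton
    (fun e f => ∃ a q : ℕ, 0 < q ∧ e = (Finset.range r).image (fun i => a + i * q) ∧
      f = threeTermProg a q) ?_ ?_
  · intro e he
    obtain ⟨heA, a, q, hq, rfl⟩ := mem_arithProgs.1 he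
    refine ⟨threeTermProg a q, mem_arithProgs.2 ⟨?_, a, q, hq, rfl⟩, a, q, hq, rfl, rfl⟩
    exact (Finset.image_subset_image (Finset.range_subset_range.2 hr)).trans heA
  · rintro f - e ⟨-, a, q, hq, rfl, hf⟩ e' ⟨-, a', q', hq', rfl, hf'⟩
    obtain ⟨rfl, rfl⟩ := threeTermProg_inj hq hq' (hf.symm.trans hf')
    rfl

/-- Two distinct integers lie in at most three common three-term progressions. -/
theorem card_arithProgs_mem_mem_le (A : Finset ℕ) {u v : ℕ} (huv : u ≠ v) :
    Finset.card {e ∈ arithProgs A 3 | u ∈ e ∧ v ∈ e} ≤ 3 := by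
  wlog h : u < v generalizing u v
  · simpa only [and_comm] using this huv.symm (by omega)
  have hsub : ({e ∈ arithProgs A 3 | u ∈ e ∧ v ∈ e} : Finset (Finset ℕ)) ⊆
      {threeTermProg u (v - u), threeTermProg u ((v - u) / 2),
        threeTermProg (2 * u - v) (v - u)} := by
    intro e he
    obtain ⟨he, hu, hv⟩ := Finset.mem_filter.1 he
    obtain ⟨-, a, q, hq, rfl⟩ := mem_arithProgs.1 he
    change u ∈ threeTermProg a q at hu
    change v ∈ threeTermProg a q at hv
    change threeTermProg a q ∈ _
    rw [mem_threeTermProg] at hu hv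
    -- The positions of `u < v` in the progression are first and second, first and third, or second
    -- and third.
    have : (a = u ∧ q = v - u) ∨ (a = u ∧ q = (v - u) / 2) ∨ (a = 2 * u - v ∧ q = v - u) := by
      omega
    simp only [Finset.mem_insert, Finset.mem_singleton]
    rcases this with ⟨h1, h2⟩ | ⟨h1, h2⟩ | ⟨h1, h2⟩ <;> rw [h1, h2] <;> simp
  exact (Finset.card_le_card hsub).trans Finset.card_le_three

theorem card_subtype_of_mem_arithProgs {A : Finset ℕ} {r : ℕ} {e : Finset ℕ}
    (he : e ∈ arithProgs A r) : (e.subtype (· ∈ A)).card = r := by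
  obtain ⟨heA, h⟩ := mem_arithProgs.1 he
  rw [← h.card_eq, ← Finset.card_map (Function.Embedding.subtype (· ∈ A)),
    Finset.subtype_map_of_mem fun x hx => heA hx]

theorem injOn_subtype_arithProgs (A : Finset ℕ) (r : ℕ) :
    Set.InjOn (fun e : Finset ℕ => e.subtype (· ∈ A)) (arithProgs A r) := by
  intro e he f hf hef
  have h1 := Finset.subtype_map_of_mem (p := (· ∈ A)) (s := e) fun x hx =>
    (mem_arithProgs.1 he).1 hx
  have h2 := Finset.subtype_map_of_mem (p := (· ∈ A)) (s := f) fun x hx =>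
    (mem_arithProgs.1 hf).1 hx
  rw [← h1, ← h2]
  exact congrArg _ hef

theorem numMonoAP_eq_numConst {κ : Type*} (A : Finset ℕ) (r : ℕ) (x : A → κ) :
    numMonoAP A r x = numConst (arithProgs A r) (fun e => e.subtype (· ∈ A)) x := by
  unfold numMonoAP numConst
  congr 1
  refine Finset.filter_congr fun e _ => ?_
  simp only [IsMonochromatic, ConstOn, Finset.mem_subtype]
  exact ⟨fun h u hu v hv => h u v hu hv, fun h u v hu hv => h u hu v hv⟩

theorem card_arithProgs_subtype_le (A : Finset ℕ) {u v : A} (huv : u ≠ v) :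
    Finset.card {e ∈ arithProgs A 3 | u ∈ e.subtype (· ∈ A) ∧ v ∈ e.subtype (· ∈ A)} ≤ 3 := by
  simp only [Finset.mem_subtype]
  exact card_arithProgs_mem_mem_le A (fun h => huv (Subtype.ext h))

end ArithProgs

/-! ### Poisson limits from an approximate recursion; weak convergence on countable spaces -/

section PoissonLimit

/-- Tight sequences of distributions on `ℕ` that satisfy the recursion of the Poisson distribution
asymptotically converge to it. -/
theorem tendsto_poisson_of_recursion {a : ℕ → ℕ → ℝ} {μ : ℕ → ℝ} {l M : ℝ}
    (ha0 : ∀ n k, 0 ≤ a n k) (ha1 : ∀ᶠ n in atTop, ∀ k, a n k ≤ 1)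
    (hμ : Tendsto μ atTop (𝓝 l))
    (hsum : ∀ᶠ n in atTop, ∀ K : ℕ, |∑ k ∈ Finset.range (K + 1), a n k - 1| ≤ M / (K + 1))
    (hrec : ∀ k : ℕ, Tendsto (fun n => (k + 1) * a n (k + 1) - μ n * a n k) atTop (𝓝 0))
    (k : ℕ) :
    Tendsto (fun n => a n k) atTop (𝓝 (Real.exp (-l) * l ^ k / k.factorial)) := by
  have hμ0 : Tendsto (fun n => μ n - l) atTop (𝓝 0) := by
    simpa using hμ.sub_const l
  have hbdd : ∀ k, Tendsto (fun n => (μ n - l) * a n k) atTop (𝓝 0) := by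
    intro k
    refine squeeze_zero_norm' ?_ (tendsto_zero_iff_norm_tendsto_zero.1 hμ0)
    filter_upwards [ha1] with n hn
    rw [norm_mul, Real.norm_of_nonneg (ha0 n k)]
    exact mul_le_of_le_one_right (norm_nonneg _) (hn k)
  have hdiff : ∀ k : ℕ,
      Tendsto (fun n => a n k - l ^ k / k.factorial * a n 0) atTop (𝓝 0) := by
    intro k
    induction k with
    | zero => simp
    | succ k ih =>
      have h := ((hrec k).add ((hbdd k).add (ih.const_mul l))).const_mul ((k + 1 : ℝ)⁻¹)
      simp only [mul_zero, add_zero] at h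
      refine h.congr fun n => ?_
      have hk : (k + 1 : ℝ) ≠ 0 := by positivity
      have hf : (k.factorial : ℝ) ≠ 0 := by positivity
      rw [Nat.factorial_succ]
      push_cast
      field_simp
      ring
  have hexp : Tendsto (fun K => ∑ k ∈ Finset.range (K + 1), l ^ k / k.factorial) atTop
      (𝓝 (Real.exp l)) := by
    have h := (NormedSpace.expSeries_div_hasSum_exp l).tendsto_sum_nat
    rw [← Real.exp_eq_exp_ℝ] at h
    exact h.comp (tendsto_add_atTop_nat 1)
  -- Normalization fixes the mass at 0: cut at a `K` where both the exponential tail and the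
  -- escaping mass `M / (K + 1)` are below `ε / 3`, then use the convergence of the finitely many
  -- remaining terms.
  have hzero : Tendsto (fun n => Real.exp l * a n 0) atTop (𝓝 1) := by
    rw [Metric.tendsto_atTop']
    intro ε hε
    have hM : Tendsto (fun K : ℕ => M / ((K : ℝ) + 1)) atTop (𝓝 0) := by
      have := (tendsto_one_div_add_atTop_nhds_zero_nat (𝕜 := ℝ)).const_mul M
      simpa [div_eq_mul_inv] using this
    obtain ⟨K, hK1, hK2⟩ := (((Metric.tendsto_nhds.1 hexp) (ε / 3) (by positivity)).and
      ((Metric.tendsto_nhds.1 hM) (ε / 3) (by positivity))).exists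
    have hfin : Tendsto (fun n => ∑ k ∈ Finset.range (K + 1),
        (a n k - l ^ k / k.factorial * a n 0)) atTop (𝓝 0) := by
      have := tendsto_finsetSum (Finset.range (K + 1)) fun k _ => hdiff k
      simpa using this
    have hev := ((Metric.tendsto_nhds.1 hfin) (ε / 3) (by positivity)).and (ha1.and hsum)
    obtain ⟨N, hN⟩ := eventually_atTop.1 hev
    refine ⟨N, fun n hn => ?_⟩
    obtain ⟨h1, h2, h3⟩ := hN n hn.le
    specialize h3 K
    rw [Finset.sum_sub_distrib, ← Finset.sum_mul] at h1
    rw [Real.dist_eq] at *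
    set S := ∑ k ∈ Finset.range (K + 1), l ^ k / k.factorial
    set T := ∑ k ∈ Finset.range (K + 1), a n k
    have h4 : |(Real.exp l - S) * a n 0| < ε / 3 := by
      rw [abs_mul, abs_of_nonneg (ha0 n 0), abs_sub_comm]
      exact (mul_le_of_le_one_right (abs_nonneg _) (h2 0)).trans_lt hK1
    rw [sub_zero] at h1 hK2
    have h5 := (le_abs_self _).trans_lt hK2
    rw [abs_lt] at *
    rw [abs_le] at h3
    constructor <;> nlinarith
  have hzero' : Tendsto (fun n => a n 0) atTop (𝓝 (Real.exp (-l))) := by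
    have := hzero.const_mul (Real.exp (-l))
    rw [mul_one] at this
    refine this.congr fun n => ?_
    rw [← mul_assoc, ← Real.exp_add]
    simp
  have := (hdiff k).add (hzero'.const_mul (l ^ k / k.factorial))
  simp only [sub_add_cancel, zero_add] at this
  convert this using 2
  ring

/-- On a countable discrete space, pointwise convergence of the masses of the points implies weak
convergence of probability measures. -/
theorem tendsto_probabilityMeasure_of_tendsto_singleton {E : Type*} [Countable E]
    [TopologicalSpace E] [DiscreteTopology E] [MeasurableSpace E] [BorelSpace E]
    {ν : ℕ → ProbabilityMeasure E} {μ : ProbabilityMeasure E}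
    (h : ∀ z, Tendsto (fun n => (ν n : Measure E) {z}) atTop (𝓝 ((μ : Measure E) {z}))) :
    Tendsto ν atTop (𝓝 μ) := by
  -- Portmanteau: the limit mass of `G` is a supremum of finite sums of point masses, and each such
  -- sum passes to the limit.
  refine tendsto_of_forall_isOpen_le_liminf' fun G _ => ?_
  have hG : (μ : Measure E) G = ∑' z : G, (μ : Measure E) {(z : E)} := by
    conv_lhs => rw [← Set.biUnion_of_singleton G]
    rw [measure_biUnion G.to_countable]
    · intro a _ b _ hab
      simpa using hab
    · intro a _
      exact measurableSet_singleton a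
  rw [hG, ENNReal.tsum_eq_iSup_sum]
  refine iSup_le fun s => ?_
  have hlim : Tendsto (fun n => ∑ z ∈ s, (ν n : Measure E) {(z : E)}) atTop
      (𝓝 (∑ z ∈ s, (μ : Measure E) {(z : E)})) :=
    tendsto_finsetSum s fun z _ => h z
  rw [← hlim.liminf_eq]
  refine liminf_le_liminf (Eventually.of_forall fun n => ?_)
  rw [← measure_biUnion_finset (f := fun z : G => ({(z : E)} : Set E))]
  · refine measure_mono ?_
    intro x hx
    simp only [Set.mem_iUnion, Set.mem_singleton_iff] at hx
    obtain ⟨z, _, rfl⟩ := hx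
    exact z.2
  · intro a _ b _ hab
    simpa [Subtype.ext_iff] using hab
  · intro a _
    exact measurableSet_singleton _

end PoissonLimit

/-! ### First moments, and transfer between counting and the given probability spaces -/

section UniformColoring

open Classical

variable {V K ι : Type*} [Fintype V] [DecidableEq V] [Fintype K]

theorem colorProb_le_one (p : (V → K) → Prop) : colorProb p ≤ 1 := by
  unfold colorProb
  refine div_le_one_of_le₀ ?_ (by positivity)
  norm_cast
  exact (Finset.card_le_univ _).trans (by simp)

theorem abs_sum_colorProb_eq_sub_one_le (hK : 0 < Fintype.card K) (f : (V → K) → ℕ) (N : ℕ) :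
    |∑ k ∈ Finset.range N, colorProb (fun x => f x = k) - 1| ≤ colorProb (fun x => N ≤ f x) := by
  have h1 : ∑ k ∈ Finset.range N, colorProb (fun x => f x = k) =
      colorProb (fun x => f x < N) := by
    unfold colorProb
    rw [← Finset.sum_div, ← Nat.cast_sum]
    congr 2
    rw [Finset.card_eq_sum_card_fiberwise (f := f) (t := Finset.range N)]
    · refine Finset.sum_congr rfl fun k hk => congrArg _ ?_
      ext x
      have := Finset.mem_range.1 hk
      simp only [Finset.mem_filter, Finset.mem_univ, true_and]
      omega
    · intro x hx
      simpa using hx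
  have h2 : colorProb (fun _ : V → K => True) = 1 := by
    unfold colorProb
    have hc : (Fintype.card K : ℝ) ≠ 0 := by exact_mod_cast hK.ne'
    simp [hc]
  rw [h1, ← h2]
  refine abs_colorProb_sub_le fun x hx => ?_
  simpa using hx

/-- Markov's inequality in counting form; it gives tightness for `r = 3` and, with `N = 1`,
vanishing for `r ≥ 4`. -/
theorem mul_colorProb_le_numConst_le (H : Finset ι) (E : ι → Finset V) (N : ℕ) :
    N * colorProb (fun x : V → K => N ≤ numConst H E x) ≤
      ∑ e ∈ H, colorProb (fun x : V → K => ConstOn x (E e)) := by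
  unfold colorProb
  rw [← Finset.sum_div, mul_div_assoc']
  gcongr
  norm_cast
  have h : ∑ e ∈ H, Finset.card {x : V → K | ConstOn x (E e)} = ∑ x : V → K, numConst H E x := by
    unfold numConst
    simp_rw [Finset.card_filter]
    exact Finset.sum_comm
  have hS : ∀ S : Finset (V → K), (∀ x ∈ S, N ≤ numConst H E x) →
      N * S.card ≤ ∑ x : V → K, numConst H E x := fun S hS => by
    rw [mul_comm, ← smul_eq_mul]
    exact (Finset.card_nsmul_le_sum S _ N hS).trans
      (Finset.sum_le_sum_of_subset (Finset.subset_univ S))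
  rw [h]
  exact hS _ fun x hx => by simpa using hx

theorem measure_coloring {Ω : Type*} [MeasurableSpace Ω] {P : Measure Ω} {m : ℕ} (hm : 0 < m)
    {X : V → Ω → Fin m} (hXmeas : ∀ v, Measurable (X v))
    (hXunif : ∀ v a, P {ω | X v ω = a} = (m : ℝ≥0∞)⁻¹) (hXindep : iIndepFun X P)
    (p : (V → Fin m) → Prop) :
    P {ω | p (fun v => X v ω)} = ENNReal.ofReal (colorProb p) := by
  have hpt : ∀ x : V → Fin m, P {ω | (fun v => X v ω) = x} = ((m : ℝ≥0∞)⁻¹) ^ Fintype.card V := by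
    intro x
    have h := hXindep.meas_iInter (s := fun v => {ω | X v ω = x v})
      (fun v => ⟨{x v}, measurableSet_singleton _, rfl⟩)
    simp only [hXunif, Finset.prod_const, Finset.card_univ] at h
    rw [← h]
    congr 1
    ext ω
    simp [funext_iff]
  have hmeas : Measurable (fun ω v => X v ω) := measurable_pi_lambda _ hXmeas
  have hset : {ω | p (fun v => X v ω)} =
      ⋃ x ∈ ({x : V → Fin m | p x} : Finset (V → Fin m)), {ω | (fun v => X v ω) = x} := by
    ext ω
    simp
  rw [hset, measure_biUnion_finset]
  · simp only [hpt, Finset.sum_const, nsmul_eq_mul]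
    unfold colorProb
    rw [Fintype.card_fin, ENNReal.ofReal_div_of_pos (by positivity), ENNReal.ofReal_natCast,
      ENNReal.ofReal_pow (by positivity), ENNReal.ofReal_natCast, div_eq_mul_inv, ENNReal.inv_pow]
  · intro a _ b _ hab
    refine Set.disjoint_left.2 fun ω ha hb => hab ?_
    exact Eq.trans (Eq.symm ha) hb
  · intro x _
    exact hmeas (measurableSet_singleton x)

theorem integral_numConst {Ω : Type*} [MeasurableSpace Ω] {P : Measure Ω}
    [IsProbabilityMeasure P] {m : ℕ} (hm : 0 < m)
    {X : V → Ω → Fin m} (hXmeas : ∀ v, Measurable (X v))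
    (hXunif : ∀ v a, P {ω | X v ω = a} = (m : ℝ≥0∞)⁻¹) (hXindep : iIndepFun X P)
    (H : Finset ι) (E : ι → Finset V) :
    ∫ ω, (numConst H E (fun v => X v ω) : ℝ) ∂P =
      ∑ e ∈ H, colorProb (fun x : V → Fin m => ConstOn x (E e)) := by
  have hmeas : Measurable (fun ω v => X v ω) := measurable_pi_lambda _ hXmeas
  have hS : ∀ e, MeasurableSet {ω | ConstOn (fun v => X v ω) (E e)} := fun e =>
    hmeas (Set.toFinite {x : V → Fin m | ConstOn x (E e)}).measurableSet
  have hfun : ∀ ω, (numConst H E (fun v => X v ω) : ℝ) =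
      ∑ e ∈ H, {ω | ConstOn (fun v => X v ω) (E e)}.indicator (1 : Ω → ℝ) ω := by
    intro ω
    unfold numConst
    rw [Finset.card_filter]
    push_cast
    refine Finset.sum_congr rfl fun e _ => ?_
    simp [Set.indicator_apply]
  simp_rw [hfun]
  rw [integral_finsetSum]
  · refine Finset.sum_congr rfl fun e _ => ?_
    rw [integral_indicator_one (hS e), measureReal_def,
      measure_coloring hm hXmeas hXunif hXindep (fun x => ConstOn x (E e)),
      ENNReal.toReal_ofReal (colorProb_nonneg _)]
  · intro e _
    exact (integrable_const (1 : ℝ)).indicator (hS e)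

end UniformColoring

/-! ### Asymptotics of the numbers of monochromatic progressions -/

section ArithProgs

theorem sum_colorProb_constOn_arithProgs {κ : Type*} [Fintype κ] (hκ : 0 < Fintype.card κ)
    (A : Finset ℕ) {r : ℕ} (hr : 1 ≤ r) :
    ∑ e ∈ arithProgs A r, colorProb (fun x : A → κ => ConstOn x (e.subtype (· ∈ A))) =
      (arithProgs A r).card / (Fintype.card κ : ℝ) ^ (r - 1) := by
  rw [Finset.sum_congr rfl fun e he => ?_, Finset.sum_const, nsmul_eq_mul, div_eq_mul_inv]
  have hcard := card_subtype_of_mem_arithProgs he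
  rw [colorProb_constOn hκ (Finset.card_pos.1 (by omega)), hcard]

theorem mul_colorProb_le_numMonoAP_le {κ : Type*} [Fintype κ] (hκ : 0 < Fintype.card κ)
    (A : Finset ℕ) {r : ℕ} (hr : 1 ≤ r) (N : ℕ) :
    N * colorProb (fun x : A → κ => N ≤ numMonoAP A r x) ≤
      (arithProgs A r).card / (Fintype.card κ : ℝ) ^ (r - 1) := by
  rw [← sum_colorProb_constOn_arithProgs hκ A hr]
  simp_rw [numMonoAP_eq_numConst]
  exact mul_colorProb_le_numConst_le _ _ _

/-- The number of monochromatic three-term progressions is asymptotically Poisson as soon as its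
mean converges. -/
theorem tendsto_colorProb_numMonoAP_three {A : ℕ → Finset ℕ} {c : ℕ → ℕ}
    (hc : Tendsto c atTop atTop) {l : ℝ}
    (hl : Tendsto (fun n => ((arithProgs (A n) 3).card : ℝ) / (c n : ℝ) ^ 2) atTop (𝓝 l)) (k : ℕ) :
    Tendsto (fun n => colorProb (fun x : A n → Fin (c n) => numMonoAP (A n) 3 x = k)) atTop
      (𝓝 (Real.exp (-l) * l ^ k / k.factorial)) := by
  have hcpos : ∀ᶠ n in atTop, 0 < c n := hc.eventually_gt_atTop 0
  have hcinv : Tendsto (fun n => ((c n : ℝ))⁻¹) atTop (𝓝 0) :=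
    tendsto_inv_atTop_zero.comp (tendsto_natCast_atTop_atTop.comp hc)
  refine tendsto_poisson_of_recursion
    (a := fun n k => colorProb (fun x : A n → Fin (c n) => numMonoAP (A n) 3 x = k))
    (μ := fun n => ((arithProgs (A n) 3).card : ℝ) / (c n : ℝ) ^ 2) (M := l + 1)
    (fun n k => colorProb_nonneg _) ?_ hl ?_ ?_ k
  · exact Eventually.of_forall fun n k => colorProb_le_one _
  · filter_upwards [hcpos, hl.eventually_le_const (lt_add_one l)] with n hn hM N
    have hK : 0 < Fintype.card (Fin (c n)) := by simpa using hn
    refine (abs_sum_colorProb_eq_sub_one_le hK _ _).trans ?_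
    have := mul_colorProb_le_numMonoAP_le hK (A n) (r := 3) (by norm_num) (N + 1)
    rw [Fintype.card_fin] at this
    push_cast at this
    rw [le_div_iff₀ (by positivity), mul_comm]
    exact this.trans hM
  · intro k
    -- The Stein error with `D = 3` and `|H| = μ c²`: here `54 = 18 · 3`, `18 = 6 · 3`, and `√(|H|³)
    -- = √(μ³) c³` against the prefactor `c⁻⁴` leaves `1/c`.
    have hlim : Tendsto (fun n =>
        ((arithProgs (A n) 3).card : ℝ) / (c n : ℝ) ^ 2 * ((c n : ℝ))⁻¹ ^ 2 +
        2 * √(54 * (((arithProgs (A n) 3).card : ℝ) / (c n : ℝ) ^ 2) ^ 3) * ((c n : ℝ))⁻¹ +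
        18 * (((arithProgs (A n) 3).card : ℝ) / (c n : ℝ) ^ 2) * ((c n : ℝ))⁻¹) atTop (𝓝 0) := by
      have h := ((hl.mul (hcinv.pow 2)).add
        ((((hl.pow 3).const_mul 54).sqrt.const_mul 2).mul hcinv)).add ((hl.const_mul 18).mul hcinv)
      simpa using h
    refine squeeze_zero_norm' ?_ hlim
    filter_upwards [hcpos] with n hn
    have hK : 0 < Fintype.card (Fin (c n)) := by simpa using hn
    have h := abs_succ_mul_colorProb_sub_le (K := Fin (c n)) (H := arithProgs (A n) 3)
      (E := fun e => e.subtype (· ∈ A n)) (D := 3) hK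
      (fun e he => card_subtype_of_mem_arithProgs he) (injOn_subtype_arithProgs (A n) 3)
      (fun u v huv => card_arithProgs_subtype_le (A n) huv) k
    rw [Fintype.card_fin] at h
    simp_rw [numMonoAP_eq_numConst]
    rw [Real.norm_eq_abs]
    refine h.trans (le_of_eq ?_)
    have hc0 : (0 : ℝ) < c n := by exact_mod_cast hn
    set m : ℝ := ((arithProgs (A n) 3).card : ℝ)
    have hsqrt : √(18 * (3 : ℕ) * m ^ 3) =
        √(54 * (m / (c n : ℝ) ^ 2) ^ 3) * (c n : ℝ) ^ 3 := by
      rw [← Real.sqrt_sq (show (0 : ℝ) ≤ (c n : ℝ) ^ 3 by positivity),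
        ← Real.sqrt_mul' _ (by positivity)]
      congr 1
      push_cast
      field_simp
      ring
    rw [hsqrt]
    push_cast
    field_simp
    ring

end ArithProgs

/-- For `r ≥ 4` there are with high probability no monochromatic `r`-term progressions. -/
theorem tendsto_colorProb_numMonoAP_ne_zero {A : ℕ → Finset ℕ} {c : ℕ → ℕ}
    (hc : Tendsto c atTop atTop) {l : ℝ}
    (hl : Tendsto (fun n => ((arithProgs (A n) 3).card : ℝ) / (c n : ℝ) ^ 2) atTop (𝓝 l))
    {r : ℕ} (hr : 4 ≤ r) :
    Tendsto (fun n => ((arithProgs (A n) r).card : ℝ) / (c n : ℝ) ^ (r - 1)) atTop (𝓝 0) ∧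
    Tendsto (fun n => colorProb (fun x : A n → Fin (c n) => numMonoAP (A n) r x ≠ 0)) atTop
      (𝓝 0) := by
  have hcpos : ∀ᶠ n in atTop, 0 < c n := hc.eventually_gt_atTop 0
  have hcinv : Tendsto (fun n => ((c n : ℝ))⁻¹) atTop (𝓝 0) :=
    tendsto_inv_atTop_zero.comp (tendsto_natCast_atTop_atTop.comp hc)
  have h1 : Tendsto (fun n => ((arithProgs (A n) r).card : ℝ) / (c n : ℝ) ^ (r - 1)) atTop
      (𝓝 0) := by
    have h := hl.mul hcinv
    rw [mul_zero] at h
    refine squeeze_zero' (Eventually.of_forall fun n => by positivity) ?_ h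
    filter_upwards [hcpos] with n hn
    have hc1 : (1 : ℝ) ≤ c n := by exact_mod_cast hn
    have hle : ((arithProgs (A n) r).card : ℝ) ≤ (arithProgs (A n) 3).card := by
      exact_mod_cast card_arithProgs_le (A n) (by omega)
    rw [← div_eq_mul_inv, div_div, ← pow_succ]
    refine div_le_div₀ (by positivity) hle (by positivity) ?_
    exact pow_le_pow_right₀ hc1 (by omega)
  refine ⟨h1, squeeze_zero' (Eventually.of_forall fun n => colorProb_nonneg _) ?_ h1⟩
  filter_upwards [hcpos] with n hn
  have h := mul_colorProb_le_numMonoAP_le (κ := Fin (c n)) (by simpa using hn) (A n)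
    (r := r) (by omega) 1
  rw [Fintype.card_fin] at h
  simpa [Nat.one_le_iff_ne_zero] using h

theorem tendsto_colorProb_numMonoAP {d : ℕ} (hd : 3 ≤ d) {A : ℕ → Finset ℕ} {c : ℕ → ℕ}
    (hc : Tendsto c atTop atTop) {lam : Finset.Icc 3 d → ℝ≥0}
    (hl : ∀ r : Finset.Icc 3 d, Tendsto
      (fun n => ((arithProgs (A n) r).card : ℝ) / (c n : ℝ) ^ ((r : ℕ) - 1)) atTop
      (𝓝 (lam r : ℝ)))
    (z : Finset.Icc 3 d → ℕ) :
    Tendsto (fun n => colorProb (fun x : A n → Fin (c n) =>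
      ∀ r : Finset.Icc 3 d, numMonoAP (A n) r x = z r)) atTop
      (𝓝 (∏ r, Real.exp (-(lam r : ℝ)) * (lam r : ℝ) ^ z r / (z r).factorial)) := by
  let s : Finset.Icc 3 d := ⟨3, Finset.mem_Icc.2 ⟨le_rfl, hd⟩⟩
  have hs : Tendsto (fun n => ((arithProgs (A n) 3).card : ℝ) / (c n : ℝ) ^ 2) atTop
      (𝓝 (lam s : ℝ)) := hl s
  have hfour : ∀ r, r ≠ s → 4 ≤ (r : ℕ) := by
    intro r hr
    have h3 := (Finset.mem_Icc.1 r.2).1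
    have : (r : ℕ) ≠ 3 := fun h => hr (Subtype.ext h)
    omega
  have hlam : ∀ r, r ≠ s → (lam r : ℝ) = 0 := fun r hr =>
    tendsto_nhds_unique (hl r) (tendsto_colorProb_numMonoAP_ne_zero hc hs (hfour r hr)).1
  have hzero : ∀ r, r ≠ s → Tendsto (fun n => colorProb (fun x : A n → Fin (c n) =>
      numMonoAP (A n) r x ≠ 0)) atTop (𝓝 0) := fun r hr =>
    (tendsto_colorProb_numMonoAP_ne_zero hc hs (hfour r hr)).2
  -- The limit law lives on vectors supported at the coordinate 3. On these the joint event differs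
  -- from `W_3 = z_3` only when some longer progression is monochromatic; any other vector forces
  -- such a progression.
  by_cases hz : ∀ r, r ≠ s → z r = 0
  · have hprod : ∏ r, Real.exp (-(lam r : ℝ)) * (lam r : ℝ) ^ z r / (z r).factorial =
        Real.exp (-(lam s : ℝ)) * (lam s : ℝ) ^ z s / (z s).factorial := by
      refine Fintype.prod_eq_single s fun r hr => ?_
      simp [hlam r hr, hz r hr]
    rw [hprod]
    have hmain := tendsto_colorProb_numMonoAP_three hc hs (z s)
    have herr : Tendsto (fun n => ∑ r ∈ Finset.univ.erase s,
        colorProb (fun x : A n → Fin (c n) => numMonoAP (A n) r x ≠ 0)) atTop (𝓝 0) := by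
      have := tendsto_finsetSum (Finset.univ.erase s) fun r hr =>
        hzero r (Finset.ne_of_mem_erase hr)
      simpa using this
    refine tendsto_of_tendsto_of_dist hmain (squeeze_zero (fun n => dist_nonneg) (fun n => ?_) herr)
    rw [Real.dist_eq]
    refine (abs_colorProb_sub_le (r := fun x : A n → Fin (c n) =>
      ∃ r ∈ Finset.univ.erase s, numMonoAP (A n) r x ≠ 0) fun x hx => ?_).trans
      (colorProb_exists_le _ _)
    push Not at hx
    refine ⟨fun h r => ?_, fun h => h s⟩
    by_cases hr : r = s
    · rw [hr]; exact h
    · rw [hz r hr]; exact hx r (Finset.mem_erase.2 ⟨hr, Finset.mem_univ r⟩)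
  · push Not at hz
    obtain ⟨r, hr, hzr⟩ := hz
    have hprod : ∏ r, Real.exp (-(lam r : ℝ)) * (lam r : ℝ) ^ z r / (z r).factorial = 0 := by
      refine Finset.prod_eq_zero (Finset.mem_univ r) ?_
      simp [hlam r hr, hzr]
    rw [hprod]
    refine squeeze_zero (fun n => colorProb_nonneg _) (fun n => colorProb_mono fun x hx => ?_)
      (hzero r hr)
    rw [hx r]
    exact hzr

theorem corollary1p8
    (d : ℕ) (hd : 3 ≤ d)
    (A : ℕ → Finset ℕ) (hA : ∀ n, A n ⊆ Finset.Icc 1 n)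
    (hAcard : Tendsto (fun n => (A n).card) atTop atTop)
    (c : ℕ → ℕ) (hc : Tendsto c atTop atTop)
    {Ω : ℕ → Type*} [∀ n, MeasurableSpace (Ω n)]
    (P : ∀ n, Measure (Ω n)) [∀ n, IsProbabilityMeasure (P n)]
    -- `X n v` is the random color of the element `v` of `A n`
    (X : ∀ n, A n → Ω n → Fin (c n))
    (hXmeas : ∀ n v, Measurable (X n v))
    (hXunif : ∀ n v a, P n {ω | X n v ω = a} = (c n : ℝ≥0∞)⁻¹)
    (hXindep : ∀ n, iIndepFun (X n) (P n))
    (lam : Finset.Icc 3 d → ℝ≥0)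
    (hmean : ∀ r : Finset.Icc 3 d,
      Tendsto (fun n => ∫ ω, (numMonoAP (A n) r (fun v => X n v ω) : ℝ) ∂(P n))
        atTop (𝓝 (lam r : ℝ)))
    (hvar : ∀ r : Finset.Icc 3 d,
      Tendsto (fun n => variance (fun ω => (numMonoAP (A n) r (fun v => X n v ω) : ℝ)) (P n))
        atTop (𝓝 (lam r : ℝ))) :
    -- the limit `(Z_3, …, Z_d)` is the identity map under the product of the Poisson laws
    TendstoInDistribution
      (fun n ω (r : Finset.Icc 3 d) => numMonoAP (A n) r (fun v => X n v ω))
      atTop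
      (fun z : Finset.Icc 3 d → ℕ => z)
      P
      (Measure.pi (fun r : Finset.Icc 3 d => poissonMeasure (lam r))) := by
  have hcpos : ∀ᶠ n in atTop, 0 < c n := hc.eventually_gt_atTop 0
  have hl : ∀ r : Finset.Icc 3 d, Tendsto
      (fun n => ((arithProgs (A n) r).card : ℝ) / (c n : ℝ) ^ ((r : ℕ) - 1)) atTop
      (𝓝 (lam r : ℝ)) := by
    -- The mean of `W_r` equals the number of `r`-APs divided by `c^(r-1)` once `c n > 0`.
    intro r
    refine (hmean r).congr' ?_
    filter_upwards [hcpos] with n hn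
    simp_rw [numMonoAP_eq_numConst]
    rw [integral_numConst hn (hXmeas n) (hXunif n) (hXindep n),
      sum_colorProb_constOn_arithProgs (by simpa using hn) (A n)
        ((by norm_num : 1 ≤ 3).trans (Finset.mem_Icc.1 r.2).1), Fintype.card_fin]
  have hmeas : ∀ n, Measurable
      (fun ω (r : Finset.Icc 3 d) => numMonoAP (A n) r (fun v => X n v ω)) := fun n =>
    (measurable_of_finite (fun (x : A n → Fin (c n)) (r : Finset.Icc 3 d) =>
      numMonoAP (A n) r x)).comp (measurable_pi_lambda _ (hXmeas n))
  refine ⟨fun n => (hmeas n).aemeasurable, aemeasurable_id, ?_⟩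
  refine tendsto_probabilityMeasure_of_tendsto_singleton fun z => ?_
  have hlim : ((Measure.pi fun r : Finset.Icc 3 d => poissonMeasure (lam r)).map fun z => z) {z} =
      ENNReal.ofReal (∏ r, Real.exp (-(lam r : ℝ)) * (lam r : ℝ) ^ z r / (z r).factorial) := by
    rw [Measure.map_id', Measure.pi_singleton, ENNReal.ofReal_prod_of_nonneg]
    · exact Finset.prod_congr rfl fun r _ => poissonMeasure_singleton _ _
    · intro r _
      positivity
  change Tendsto _ atTop (𝓝 (((Measure.pi fun r : Finset.Icc 3 d =>
    poissonMeasure (lam r)).map fun z => z) {z}))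
  rw [hlim]
  refine (ENNReal.tendsto_ofReal (tendsto_colorProb_numMonoAP hd hc hl z)).congr' ?_
  filter_upwards [hcpos] with n hn
  rw [← measure_coloring hn (hXmeas n) (hXunif n) (hXindep n)]
  change _ = ((P n).map _) {z}
  rw [Measure.map_apply (hmeas n) (measurableSet_singleton z)]
  congr 1
  ext ω
  simp [funext_iff]
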